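/- Vertex recoloring problem. A finite vertex set $V$ with an initial coloring $c_0:V\to\{1,2\}$ by two basic colors is given, and edges $\sigma=(e_1,\dots,e_m)$ on $V$ arrive one at a time. After the arrival of each $e_i$ one must hold a coloring $c_i$ of $V$ under which no edge of $\{e_1,\dots,e_i\}$ is monochromatic. The coloring may be changed in each step, and each recoloring of a vertex costs the price of its new color. Each of the two basic colors has price $1$. Let $\mathrm{OPT}_2(\sigma)$ be the minimum total cost of an offline solution that uses only the two basic colors. For a graph $G$, a bond is the set of all edges between $A$ and $B$, where $A,B$ are disjoint nonempty vertex sets that both induce connected subgraphs and whose union is the vertex set of a connected component of $G$; let $\beta(G)$ be the largest size of a bond of $G$ ($0$ if $G$ has no edge). **Theorem.** There is an absolute constant $C>0$ such that the following holds for every finite set $V$, every initial coloring $c_0:V\to\{1,2\}$, every integer $\Delta\ge 0$, every real $D\ge 1$, and any $\Delta$ additional special colors with prices in $[0,D]$. There is a deterministic online algorithm, using only the two basic colors and these $\Delta$ special colors, that on every sequence $\sigma$ of (non-loop) edges whose graph $G=(V,\{e_1,\dots,e_m\})$ is bipartite with maximum degree at most $\Delta$ holds a valid coloring after every step and has total cost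 at most $$C\,\bigl(\log D+\beta(G)^2\bigr)\cdot \mathrm{OPT}_2(\sigma).$$ (That is, the competitive ratio $O(\log D+\beta^2)$, known with $\Delta+1$ special colors, is achieved with only $\Delta$ special colors.) The algorithm knows $V$, $c_0$, $\Delta$, $D$ and the prices in advance, but not $\beta(G)$. -/

import Mathlib

universe u

namespace Recoloring

/-- The simple graph on `V` whose edges are the edges of the list `σ`. -/
def inputGraph {V : Type u} (σ : List (Sym2 V)) : SimpleGraph V :=
  SimpleGraph.fromEdgeSet {e | e ∈ σ}

open Classical in
/-- `σ` is a legal input for maximum degree `Δ`: it has no self-loops, and the graph formed by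
all its edges is bipartite and has maximum degree at most `Δ`. -/
def IsBipartiteInput {V : Type u} [Fintype V] (Δ : ℕ) (σ : List (Sym2 V)) : Prop :=
  (∀ e ∈ σ, ¬ e.IsDiag) ∧ (inputGraph σ).IsBipartite ∧ (inputGraph σ).maxDegree ≤ Δ

/-- `F` is a bond of `G`: the set of all edges between two disjoint vertex sets `A`, `B` that
both induce connected subgraphs and together make up a connected component of `G`. -/
def IsBond {V : Type u} (G : SimpleGraph V) (F : Set (Sym2 V)) : Prop :=
  ∃ (K : G.ConnectedComponent) (A B : Set V),
    Disjoint A B ∧ A ∪ B = K.supp ∧ (G.induce A).Connected ∧ (G.induce B).Connected ∧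
    F = {e | e ∈ G.edgeSet ∧ ∃ a ∈ A, ∃ b ∈ B, e = s(a, b)}

/-- The size of a largest bond of `G` (`0` if there is no bond, that is, no edge). -/
noncomputable def largestBond {V : Type u} (G : SimpleGraph V) : ℕ :=
  sSup {k | ∃ F, IsBond G F ∧ F.ncard = k}

/-- In a finite graph the supremum defining `largestBond` is over a bounded set. -/
theorem IsBond.ncard_le_largestBond {V : Type u} [Finite V] {G : SimpleGraph V}
    {F : Set (Sym2 V)} (hF : IsBond G F) : F.ncard ≤ largestBond G := by
  refine le_csSup ⟨(Set.univ : Set (Sym2 V)).ncard, ?_⟩ ⟨F, hF, rfl⟩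
  rintro k ⟨F', -, rfl⟩
  exact Set.ncard_le_ncard (Set.subset_univ _) Set.finite_univ

/-- `c` is a valid coloring of `G`: no edge is monochromatic. -/
def IsValid {V : Type u} {K : Type} (G : SimpleGraph V) (c : V → K) : Prop :=
  ∀ ⦃x y : V⦄, G.Adj x y → c x ≠ c y

/-- The total cost of the first `m` steps of a sequence of colorings `s 0, s 1, …`, where each
recoloring of a vertex costs the price `w` of its new color. -/
def totalCost {V : Type u} [Fintype V] {K : Type} [DecidableEq K] (w : K → ℝ) (m : ℕ)
    (s : ℕ → V → K) : ℝ :=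
  ∑ i ∈ Finset.range m, ∑ v : V, if s (i + 1) v ≠ s i v then w (s (i + 1) v) else 0

/-- `s` serves the edge sequence `σ` from the initial coloring `c₀`: it starts with `c₀`, and
after each step `i` the coloring `s i` is valid for the graph of the first `i` edges. -/
def Serves {V : Type u} {K : Type} (c₀ : V → K) (σ : List (Sym2 V)) (s : ℕ → V → K) : Prop :=
  s 0 = c₀ ∧ ∀ i ≤ σ.length, IsValid (inputGraph (σ.take i)) (s i)

/-- The optimal offline cost of `σ` from the initial coloring `c₀` with just the two basic
colors, each of unit price. -/
noncomputable def optTwo {V : Type u} [Fintype V] (c₀ : V → Fin 2) (σ : List (Sym2 V)) : ℝ :=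
  sInf {x | ∃ s : ℕ → V → Fin 2, Serves c₀ σ s ∧ x = totalCost (fun _ => 1) σ.length s}

/-- The palette: two basic colors and `k` special colors. -/
abbrev Palette (k : ℕ) : Type := Fin 2 ⊕ Fin k

/-- The price of a color: `1` for a basic color, `w j` for the special color `j`. -/
def price {k : ℕ} (w : Fin k → ℝ) : Palette k → ℝ :=
  Sum.elim (fun _ => 1) w

/-- A deterministic online algorithm: the coloring that it holds after a sequence of arrivals
is a function of just the edges that have arrived, and is `c₀` before the first arrival. -/
structure OnlineAlgorithm (V : Type u) (K : Type) (c₀ : V → K) where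
  coloring : List (Sym2 V) → V → K
  init : coloring [] = c₀

/-- The sequence of colorings that the algorithm goes through on the input `σ`. -/
def OnlineAlgorithm.run {V : Type u} {K : Type} {c₀ : V → K} (alg : OnlineAlgorithm V K c₀)
    (σ : List (Sym2 V)) : ℕ → V → K :=
  fun i => alg.coloring (σ.take i)

end Recoloring

/-! The optimum is at least the number of vertices on which some valid final 2-coloring `h` differs
from `c₀`, so all costs are charged to this distance, for an arbitrary `h`.

Let K be the component of a new edge xy. If some valid 2-coloring of K differs from `c₀` on less
than a quarter of K, then K is recolored to it (a reset). Otherwise every `h` pays for at least a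
quarter of K, and all of K is declared `paid`. If in that case the edge joins two components and the
smaller has fewer than `D` vertices, the smaller one is recolored; its component at least doubles,
so a vertex undergoes this O(1 + log D) times. Any other edge recolors at most one endpoint, at
price at most `D`.

These single recolorings are counted through bonds. The vertices are partitioned into connected
classes, each a whole component or of size at least `D`, and the basic colors are consistent inside
each class. A clash of basic colors therefore joins two different classes with at least `D` paid
vertices each, and contracting classes one edge at a time (`card_le_largestBond_mul`) gives D ·
#(basic clashes) ≤ β · #paid. Only a basic clash creates a new special vertex, and a clash of
special colors joins two such vertices; the same count with singleton classes gives #(special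
clashes) ≤ β · #(basic clashes). Hence the β². Resets are paid by a potential, the distance from the
current coloring to `h`.

Only Δ special colors are needed because a vertex whose neighbors use all of them has no neighbor
left to block a basic color (`exists_free_color`). -/

namespace Recoloring

/-! ### Bonds and edges between connected classes -/

section Bonds

variable {V : Type u}

/-- The number of edges between two disjoint adjacent connected sets is at most the size of a
largest bond: a maximal pair of disjoint connected supersets spans a component. -/
theorem ncard_between_le_largestBond [Finite V] {G : SimpleGraph V} {X Y : Set V}
    (hX : (G.induce X).Connected) (hY : (G.induce Y).Connected) (hd : Disjoint X Y)
    {x y : V} (hx : x ∈ X) (hy : y ∈ Y) (hxy : G.Adj x y) :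
    {e | e ∈ G.edgeSet ∧ ∃ a ∈ X, ∃ b ∈ Y, e = s(a, b)}.ncard ≤ largestBond G := by
  classical
  let Good : Set V × Set V → Prop := fun p =>
    (G.induce p.1).Connected ∧ (G.induce p.2).Connected ∧ Disjoint p.1 p.2
  obtain ⟨⟨A, B⟩, hle, hmax⟩ := Finite.exists_le_maximal (p := Good) (a := (X, Y)) ⟨hX, hY, hd⟩
  obtain ⟨hXA, hYB⟩ : X ⊆ A ∧ Y ⊆ B := hle
  obtain ⟨hA, hB, hAB⟩ : (G.induce A).Connected ∧ (G.induce B).Connected ∧ Disjoint A B := hmax.prop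
  -- An outside neighbor of `A` or of `B` could be added to that side, against maximality.
  have grow : ∀ u w, u ∈ A ∪ B → G.Adj u w → w ∈ A ∪ B := by
    intro u w hu huw
    by_contra hw
    have hwA : w ∉ A := fun h => hw (Or.inl h)
    have hwB : w ∉ B := fun h => hw (Or.inr h)
    have single : (G.induce {w}).Preconnected := by
      rintro ⟨a, rfl⟩ ⟨b, rfl⟩
      exact SimpleGraph.Reachable.refl _
    rcases hu with hu | hu
    · have hc : (G.induce (A ∪ {w})).Connected :=
        SimpleGraph.connected_induce_union hA.preconnected single hu rfl huw
      have := (hmax.le_of_ge (y := (A ∪ {w}, B)) ⟨hc, hB, by simp [hAB, hwB]⟩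
        ⟨Set.subset_union_left, le_rfl⟩).1
      exact hwA (this (Or.inr rfl))
    · have hc : (G.induce (B ∪ {w})).Connected :=
        SimpleGraph.connected_induce_union hB.preconnected single hu rfl huw
      have := (hmax.le_of_ge (y := (A, B ∪ {w})) ⟨hA, hc, by simp [hAB, hwA]⟩
        ⟨le_rfl, Set.subset_union_left⟩).2
      exact hwB (this (Or.inr rfl))
  have reachA : ∀ v ∈ A, G.Reachable v x := fun v hv =>
    (hA.preconnected ⟨v, hv⟩ ⟨x, hXA hx⟩).map (SimpleGraph.Embedding.induce A).toHom
  have reachB : ∀ v ∈ B, G.Reachable v y := fun v hv =>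
    (hB.preconnected ⟨v, hv⟩ ⟨y, hYB hy⟩).map (SimpleGraph.Embedding.induce B).toHom
  have hsupp : A ∪ B = (G.connectedComponentMk x).supp := by
    ext v
    rw [SimpleGraph.ConnectedComponent.mem_supp_iff, SimpleGraph.ConnectedComponent.eq]
    constructor
    · rintro (hv | hv)
      · exact reachA v hv
      · exact (reachB v hv).trans hxy.symm.reachable
    · rintro h
      obtain ⟨p⟩ := h.symm
      by_contra hv
      obtain ⟨d, -, hd1, hd2⟩ := p.exists_boundary_dart (A ∪ B) (Or.inl (hXA hx)) hv
      exact hd2 (grow _ _ hd1 d.adj)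
  have hbond : IsBond G {e | e ∈ G.edgeSet ∧ ∃ a ∈ A, ∃ b ∈ B, e = s(a, b)} :=
    ⟨_, A, B, hAB, hsupp, hA, hB, rfl⟩
  refine le_trans (Set.ncard_le_ncard ?_ (Set.toFinite _)) hbond.ncard_le_largestBond
  rintro e ⟨he, a, ha, b, hb, rfl⟩
  exact ⟨he, a, hXA ha, b, hYB hb, rfl⟩

/-- The subgraph of the edges whose endpoints carry the same label. -/
def within (G : SimpleGraph V) (f : V → V) : SimpleGraph V where
  Adj u v := G.Adj u v ∧ f u = f v
  symm := ⟨fun _ _ h => ⟨h.1.symm, h.2.symm⟩⟩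
  loopless := ⟨fun _ h => h.1.ne rfl⟩

/-- Each label class is connected in `G`. -/
def ConnectedFibers (G : SimpleGraph V) (f : V → V) : Prop :=
  ∀ u v, f u = f v → (within G f).Reachable u v

theorem within_le (G : SimpleGraph V) (f : V → V) : within G f ≤ G := fun _ _ h => h.1

theorem ConnectedFibers.reachable {G : SimpleGraph V} {f : V → V} (hf : ConnectedFibers G f)
    {u v : V} (h : f u = f v) : G.Reachable u v :=
  (hf u v h).mono (within_le G f)

theorem ConnectedFibers.induce_connected {G : SimpleGraph V} {f : V → V}
    (hf : ConnectedFibers G f) (x : V) : (G.induce {v | f v = f x}).Connected := by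
  have key : ∀ u v (p : (within G f).Walk u v) (hu : f u = f x) (hv : f v = f x),
      (G.induce {v | f v = f x}).Reachable ⟨u, hu⟩ ⟨v, hv⟩ := by
    intro u v p
    induction p with
    | nil => intro _ _; exact SimpleGraph.Reachable.refl _
    | cons h p ih =>
      intro hu hv
      have hw := h.2.symm.trans hu
      refine SimpleGraph.Reachable.trans (SimpleGraph.Adj.reachable ?_) (ih hw hv)
      exact h.1
  have : Nonempty {v | f v = f x} := ⟨⟨x, rfl⟩⟩
  refine ⟨?_⟩
  rintro ⟨u, hu⟩ ⟨v, hv⟩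
  obtain ⟨p⟩ := hf u v (Eq.trans hu (Eq.symm hv))
  exact key u v p hu hv

open Classical in
/-- A set of edges between different connected classes that touches `#T` of the classes has at
most `largestBond G * #T` elements: contract the classes joined by an edge. -/
theorem card_le_largestBond_mul [Finite V] {G : SimpleGraph V} (T : Finset V) :
    ∀ (f : V → V) (F : Finset (Sym2 V)), ConnectedFibers G f →
      (∀ u v, s(u, v) ∈ F → G.Adj u v ∧ f u ≠ f v ∧ f u ∈ T) →
      F.card ≤ largestBond G * T.card := by
  induction T using Finset.strongInduction with
  | H T ih =>
  intro f F hf hF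
  rcases F.eq_empty_or_nonempty with rfl | ⟨e, he⟩
  · simp
  induction e using Sym2.ind with
  | h x y =>
  obtain ⟨hxy, hne, hxT⟩ := hF x y he
  -- The edge xy is contracted: the class of `x` joins that of `y`. The edges lost lie between these
  -- two classes, at most one bond's worth, and the label `f x` disappears from `T`.
  let f' : V → V := fun v => if f v = f x then f y else f v
  let E : Set (Sym2 V) := {e | e ∈ G.edgeSet ∧ ∃ a ∈ {v | f v = f x}, ∃ b ∈ {v | f v = f y},
    e = s(a, b)}
  have hE : E.ncard ≤ largestBond G := by
    refine ncard_between_le_largestBond (hf.induce_connected x) (hf.induce_connected y) ?_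
      (x := x) (y := y) rfl rfl hxy
    rw [Set.disjoint_left]
    intro v hv hv'
    exact hne (Eq.trans (Eq.symm hv) hv')
  have hle : within G f ≤ within G f' := fun u v h => ⟨h.1, by simp only [f', h.2]⟩
  have hf' : ConnectedFibers G f' := by
    have hfx : f' x = f y := by simp [f']
    have hfy : f' y = f y := by simp [f']
    have toY : ∀ u, f' u = f y → (within G f').Reachable u y := by
      intro u hu
      by_cases h : f u = f x
      · refine ((hf u x h).mono hle).trans (SimpleGraph.Adj.reachable ⟨hxy, hfx.trans hfy.symm⟩)
      · refine (hf u y ?_).mono hle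
        simpa [f', h] using hu
    intro u v h
    by_cases hu : f' u = f y
    · exact (toY u hu).trans (toY v (h.symm.trans hu)).symm
    · have hu' : f u ≠ f x := fun h' => hu (by simp [f', h'])
      have hv' : f v ≠ f x := fun h' => hu (h.trans (by simp [f', h']))
      refine (hf u v ?_).mono hle
      simpa [f', hu', hv'] using h
  have hcard : (F.filter (· ∉ E)).card ≤ largestBond G * (T.erase (f x)).card := by
    refine ih _ (Finset.erase_ssubset hxT) f' _ hf' ?_
    intro u v huv
    rw [Finset.mem_filter] at huv
    obtain ⟨hadj, hne', huT⟩ := hF u v huv.1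
    have hvT := (hF v u (by rw [Sym2.eq_swap]; exact huv.1)).2.2
    have hyT := (hF y x (by rw [Sym2.eq_swap]; exact he)).2.2
    refine ⟨hadj, fun h => ?_, ?_⟩
    · apply huv.2
      by_cases hu : f u = f x
      · by_cases hv : f v = f x
        · exact absurd (hu.trans hv.symm) hne'
        · exact ⟨hadj, u, hu, v, by simpa [f', hu, hv] using h.symm, rfl⟩
      · by_cases hv : f v = f x
        · exact ⟨hadj, v, hv, u, by simpa [f', hu, hv] using h, Sym2.eq_swap⟩
        · exact absurd (by simpa [f', hu, hv] using h) hne'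
    · rw [Finset.mem_erase]
      by_cases hu : f u = f x
      · simp only [f', hu, if_true]
        exact ⟨hne.symm, hyT⟩
      · simp only [f', hu, if_false]
        exact ⟨hu, huT⟩
  have hin : (F.filter (· ∈ E)).card ≤ largestBond G := by
    refine le_trans ?_ hE
    rw [← Set.ncard_coe_finset]
    exact Set.ncard_le_ncard (by intro e; simp) (Set.toFinite _)
  have hT := Finset.card_erase_add_one hxT
  have hsplit := Finset.card_filter_add_card_filter_not (s := F) (· ∈ E)
  calc F.card ≤ largestBond G + largestBond G * (T.erase (f x)).card := by omega
    _ = largestBond G * T.card := by rw [← hT]; ring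

theorem connectedFibers_id (G : SimpleGraph V) : ConnectedFibers G id := by
  rintro u v (rfl : u = v)
  exact SimpleGraph.Reachable.refl _

theorem one_le_largestBond [Finite V] {G : SimpleGraph V} {x y : V} (h : G.Adj x y) :
    1 ≤ largestBond G := by
  classical
  have := card_le_largestBond_mul (G := G) {x, y} id {s(x, y)} (connectedFibers_id G) (by
    intro u v huv
    rw [Finset.mem_singleton, Sym2.eq_iff] at huv
    rcases huv with ⟨rfl, rfl⟩ | ⟨rfl, rfl⟩
    · exact ⟨h, h.ne, by simp⟩
    · exact ⟨h.symm, h.symm.ne, by simp⟩)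
  rw [Finset.card_singleton] at this
  by_contra hc
  have h0 : largestBond G = 0 := by omega
  simp [h0] at this

end Bonds

/-! ### Components and connected classes under edge insertion -/

section Labels

variable {V : Type u}

/-- `G'` is obtained from `G` by the insertion of the edge `xy`. -/
structure AddsEdge (G G' : SimpleGraph V) (x y : V) : Prop where
  adj_iff : ∀ u v, G'.Adj u v ↔ G.Adj u v ∨ (u = x ∧ v = y) ∨ (u = y ∧ v = x)

namespace AddsEdge

variable {G G' : SimpleGraph V} {x y : V}

theorem le (h : AddsEdge G G' x y) : G ≤ G' := fun u v huv => (h.adj_iff u v).2 (Or.inl huv)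

theorem adj (h : AddsEdge G G' x y) : G'.Adj x y := (h.adj_iff x y).2 (by simp)

theorem symm (h : AddsEdge G G' x y) : AddsEdge G G' y x :=
  ⟨fun u v => by rw [h.adj_iff]; tauto⟩

theorem reachable (h : AddsEdge G G' x y) {u v : V} (huv : G'.Reachable u v) :
    G.Reachable u v ∨ ((G.Reachable x u ∨ G.Reachable y u) ∧ (G.Reachable x v ∨ G.Reachable y v)) := by
  obtain ⟨p⟩ := huv
  induction p with
  | nil => exact Or.inl (SimpleGraph.Reachable.refl _)
  | @cons a b c hab p ih =>
    rcases (h.adj_iff a b).1 hab with hab | ⟨rfl, rfl⟩ | ⟨rfl, rfl⟩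
    · rcases ih with ih | ⟨h1 | h1, h2⟩
      · exact Or.inl (hab.reachable.trans ih)
      · exact Or.inr ⟨Or.inl (h1.trans hab.symm.reachable), h2⟩
      · exact Or.inr ⟨Or.inr (h1.trans hab.symm.reachable), h2⟩
    · refine Or.inr ⟨Or.inl (SimpleGraph.Reachable.refl _), ?_⟩
      rcases ih with ih | ih
      · exact Or.inr ih
      · exact ih.2
    · refine Or.inr ⟨Or.inr (SimpleGraph.Reachable.refl _), ?_⟩
      rcases ih with ih | ih
      · exact Or.inl ih
      · exact ih.2

end AddsEdge

open Classical in
/-- The vertex set of the component of `x`. -/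
noncomputable def comp [Fintype V] (G : SimpleGraph V) (x : V) : Finset V :=
  Finset.univ.filter (G.Reachable x)

@[simp]
theorem mem_comp [Fintype V] {G : SimpleGraph V} {x v : V} : v ∈ comp G x ↔ G.Reachable x v := by
  simp [comp]

theorem comp_mono [Fintype V] {G G' : SimpleGraph V} (h : G ≤ G') (x : V) :
    comp G x ⊆ comp G' x := fun v hv => by
  rw [mem_comp] at *
  exact hv.mono h

open Classical in
/-- The label class of `x`. -/
noncomputable def fiber [Fintype V] (f : V → V) (x : V) : Finset V :=
  Finset.univ.filter (fun v => f v = f x)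

@[simp]
theorem mem_fiber [Fintype V] {f : V → V} {x v : V} : v ∈ fiber f x ↔ f v = f x := by
  simp [fiber]

/-- Each label class is connected, and is a component or has at least `D` elements. -/
structure Labeling [Fintype V] (D : ℝ) (G : SimpleGraph V) (f : V → V) : Prop where
  conn : ConnectedFibers G f
  large : ∀ v, (∀ u, G.Reachable v u → f u = f v) ∨ D ≤ (fiber f v).card

/-- A class lies inside a component, so a component below `D` has no room for a class of size `D`
and must be a single class. -/
theorem Labeling.eq_of_small [Fintype V] {D : ℝ} {G : SimpleGraph V} {f : V → V}
    (hf : Labeling D G f) {v u : V} (hv : ((comp G v).card : ℝ) < D) (hu : G.Reachable v u) :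
    f u = f v := by
  rcases hf.large v with h | h
  · exact h u hu
  · exfalso
    have : (fiber f v).card ≤ (comp G v).card := Finset.card_le_card fun w hw => by
      rw [mem_fiber] at hw
      rw [mem_comp]
      exact hf.conn.reachable hw.symm
    have : ((fiber f v).card : ℝ) ≤ (comp G v).card := by exact_mod_cast this
    linarith

theorem Labeling.le_card_fiber [Fintype V] {D : ℝ} {G : SimpleGraph V} {f : V → V}
    (hf : Labeling D G f) {v : V} (hv : D ≤ ((comp G v).card : ℝ)) : D ≤ (fiber f v).card := by
  rcases hf.large v with h | h
  · have : (comp G v).card ≤ (fiber f v).card := Finset.card_le_card fun w hw => by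
      rw [mem_comp] at hw
      rw [mem_fiber]
      exact h w hw
    have : ((comp G v).card : ℝ) ≤ (fiber f v).card := by exact_mod_cast this
    linarith
  · exact h

/-- How the labels may change upon an insertion: classes stay together, only classes inside the
component of the new edge are joined, and classes joined by an edge are not joined. -/
structure LabelStep (G G' : SimpleGraph V) (x : V) (f f' : V → V) : Prop where
  eq_or : ∀ u v, f' u = f' v → f u = f v ∨ (G'.Reachable x u ∧ G'.Reachable x v)
  ne : ∀ u v, G.Adj u v → f u ≠ f v → f' u ≠ f' v
  mono : ∀ u v, G.Adj u v → f u ≠ f v → ∀ w, f w = f u → f' w = f' u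

theorem LabelStep.refl (G G' : SimpleGraph V) (x : V) (f : V → V) : LabelStep G G' x f f :=
  ⟨fun _ _ h => Or.inl h, fun _ _ _ h => h, fun _ _ _ _ _ h => h⟩

open Classical in
/-- The component of `x` gets the label of `y`. -/
noncomputable def mergeLabel (G : SimpleGraph V) (x y : V) (f : V → V) : V → V :=
  fun v => if G.Reachable x v then f y else f v

/-- The small component of `x` is a single class, and the new edge attaches it to the class of `y`.
If the latter was a whole component, so is the union; if not, every class in the component of `y`
already has `D` elements. Adjacent vertices with different labels lie outside the small component,
so their classes stay apart. -/
theorem Labeling.merge [Fintype V] {D : ℝ} {G G' : SimpleGraph V} {f : V → V} {x y : V}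
    (hf : Labeling D G f) (hG : AddsEdge G G' x y) (hxy : ¬ G.Reachable x y)
    (hx : ((comp G x).card : ℝ) < D) :
    Labeling D G' (mergeLabel G x y f) ∧ LabelStep G G' x f (mergeLabel G x y f) := by
  classical
  set f' := mergeLabel G x y f with hfdef
  have hin : ∀ v, G.Reachable x v → f' v = f y := fun v hv => by simp [hfdef, mergeLabel, hv]
  have hout : ∀ v, ¬ G.Reachable x v → f' v = f v := fun v hv => by simp [hfdef, mergeLabel, hv]
  have hfx : ∀ v, G.Reachable x v ↔ f v = f x := fun v =>
    ⟨hf.eq_of_small hx, fun h => hf.conn.reachable h.symm⟩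
  have hfy : f' y = f y := hout y hxy
  have hstep : ∀ u v, G.Adj u v → (G.Reachable x u ↔ G.Reachable x v) := fun u v h =>
    ⟨fun h' => h'.trans h.reachable, fun h' => h'.trans h.symm.reachable⟩
  have hle : within G f ≤ within G' f' := by
    intro u v h
    refine ⟨hG.le h.1, ?_⟩
    by_cases hu : G.Reachable x u
    · rw [hin u hu, hin v ((hstep u v h.1).1 hu)]
    · rw [hout u hu, hout v (fun h' => hu ((hstep u v h.1).2 h'))]
      exact h.2
  have toY : ∀ u, f' u = f y → (within G' f').Reachable u y := by
    intro u hu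
    by_cases h : G.Reachable x u
    · refine ((hf.conn u x ((hfx u).1 h)).mono hle).trans (SimpleGraph.Adj.reachable ⟨hG.adj, ?_⟩)
      rw [hin x (SimpleGraph.Reachable.refl _), hfy]
    · rw [hout u h] at hu
      exact (hf.conn u y hu).mono hle
  have hcard : ∀ u v, (∀ w, f w = f u → f' w = f' v) → D ≤ (fiber f u).card →
      D ≤ (fiber f' v).card := by
    intro u v h hD
    refine hD.trans ?_
    exact_mod_cast Finset.card_le_card fun w hw => by
      rw [mem_fiber] at *
      exact h w hw
  refine ⟨⟨?_, ?_⟩, ⟨?_, ?_, ?_⟩⟩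
  · intro u v h
    by_cases hu : f' u = f y
    · exact (toY u hu).trans (toY v (h.symm.trans hu)).symm
    · have hu' : ¬ G.Reachable x u := fun h' => hu (hin u h')
      have hv' : ¬ G.Reachable x v := fun h' => hu (h.trans (hin v h'))
      rw [hout u hu', hout v hv'] at h
      exact (hf.conn u v h).mono hle
  · intro v
    have yfib : ∀ w, f w = f y → f' w = f y := fun w hw => by
      by_cases h : G.Reachable x w
      · exact hin w h
      · rw [hout w h, hw]
    by_cases hv : f' v = f y
    · rcases hf.large y with h | h
      · left
        have vxy : G.Reachable x v ∨ G.Reachable y v := by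
          by_cases h' : G.Reachable x v
          · exact Or.inl h'
          · rw [hout v h'] at hv
            exact Or.inr (hf.conn.reachable hv.symm)
        have final : ∀ u, G.Reachable x u ∨ G.Reachable y u → f' u = f' v := by
          rintro u (hu | hu)
          · rw [hin u hu, hv]
          · rw [hv, yfib u (h u hu)]
        intro u hu
        rcases hG.reachable hu with h' | h'
        · exact final u (vxy.imp (·.trans h') (·.trans h'))
        · exact final u h'.2
      · right
        exact hcard y v (fun w hw => (yfib w hw).trans hv.symm) h
    · have hvx : ¬ G.Reachable x v := fun h' => hv (hin v h')
      have hvy : f v ≠ f y := by rwa [hout v hvx] at hv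
      rcases hf.large v with h | h
      · left
        intro u hu
        rcases hG.reachable hu with h' | h'
        · rw [hout v hvx, hout u (fun h'' => hvx (h''.trans h'.symm))]
          exact h u h'
        · rcases h'.1 with h'' | h''
          · exact absurd h'' hvx
          · exact absurd (h y h''.symm).symm hvy
      · right
        refine hcard v v (fun w hw => ?_) h
        rw [hout v hvx, hout w fun h' => hvx (h'.trans (hf.conn.reachable hw)), hw]
  · intro u v h
    by_cases hu : f' u = f y
    · have reach : ∀ w, f' w = f y → G'.Reachable x w := fun w hw =>
        hG.adj.reachable.trans ((toY w hw).symm.mono (within_le _ _))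
      exact Or.inr ⟨reach u hu, reach v (h.symm.trans hu)⟩
    · have hu' : ¬ G.Reachable x u := fun h' => hu (hin u h')
      have hv' : ¬ G.Reachable x v := fun h' => hu (h.trans (hin v h'))
      rw [hout u hu', hout v hv'] at h
      exact Or.inl h
  · intro u v h hne
    have hu : ¬ G.Reachable x u := fun h' =>
      hne (((hfx u).1 h').trans ((hfx v).1 ((hstep u v h).1 h')).symm)
    rw [hout u hu, hout v fun h' => hu ((hstep u v h).2 h')]
    exact hne
  · intro u v h hne w hw
    have hu : ¬ G.Reachable x u := fun h' =>
      hne (((hfx u).1 h').trans ((hfx v).1 ((hstep u v h).1 h')).symm)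
    rw [hout u hu, hout w fun h' => hu (h'.trans (hf.conn.reachable hw)), hw]

/-- An edge inside a component changes no component. An edge between two components of size at least
`D` may stop a class from being a whole component, but such a class has size at least `D`. -/
theorem Labeling.keep [Fintype V] {D : ℝ} {G G' : SimpleGraph V} {f : V → V} {x y : V}
    (hf : Labeling D G f) (hG : AddsEdge G G' x y)
    (hxy : G.Reachable x y ∨ (D ≤ ((comp G x).card : ℝ) ∧ D ≤ ((comp G y).card : ℝ))) :
    Labeling D G' f := by
  have hle : within G f ≤ within G' f := fun _ _ h => ⟨hG.le h.1, h.2⟩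
  refine ⟨fun u v h => (hf.conn u v h).mono hle, fun v => ?_⟩
  rcases hf.large v with h | h
  · rcases hxy with hxy | ⟨hx, hy⟩
    · left
      intro u hu
      rcases hG.reachable hu with h' | ⟨h1, h2⟩
      · exact h u h'
      · have h1' : G.Reachable x v := h1.elim id hxy.trans
        have h2' : G.Reachable x u := h2.elim id hxy.trans
        exact h u (h1'.symm.trans h2')
    · by_cases hv : G.Reachable x v ∨ G.Reachable y v
      · right
        have hc : ∀ z, D ≤ ((comp G z).card : ℝ) → G.Reachable z v → D ≤ (fiber f v).card := by
          intro z hz hzv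
          refine hz.trans ?_
          exact_mod_cast Finset.card_le_card fun w hw => by
            rw [mem_comp] at hw
            rw [mem_fiber]
            exact h w (hzv.symm.trans hw)
        exact hv.elim (hc x hx) (hc y hy)
      · left
        intro u hu
        rcases hG.reachable hu with h' | h'
        · exact h u h'
        · exact absurd h'.1 hv
  · exact Or.inr h

end Labels

/-! ### Valid colorings and their modification -/

section TwoColorings

variable {V : Type u}

theorem IsValid.mono {K : Type} {G G' : SimpleGraph V} {c : V → K} (h : IsValid G' c)
    (hle : G ≤ G') : IsValid G c := fun _ _ hxy => h (hle hxy)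

/-- With two colors, both colorings switch along every edge, so agreement propagates along walks: on
a component they are equal or opposite. -/
theorem IsValid.eq_iff_of_reachable {G : SimpleGraph V} {h h' : V → Fin 2} (hh : IsValid G h)
    (hh' : IsValid G h') {u v : V} (huv : G.Reachable u v) : h u = h' u ↔ h v = h' v := by
  obtain ⟨p⟩ := huv
  induction p with
  | nil => rfl
  | cons hab p ih =>
    rw [← ih]
    have := hh hab
    have := hh' hab
    omega

open Classical in
theorem IsValid.piecewise [Fintype V] {K : Type} {G : SimpleGraph V} {c c' : V → K}
    {x : V} (hc : IsValid G c) (hc' : IsValid G c') :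
    IsValid G (fun v => if v ∈ comp G x then c v else c' v) := by
  intro u v huv
  have : u ∈ comp G x ↔ v ∈ comp G x := by
    simp only [mem_comp]
    exact ⟨(·.trans huv.reachable), (·.trans huv.symm.reachable)⟩
  by_cases hu : u ∈ comp G x
  · simp only [hu, this.1 hu, if_true]
    exact hc huv
  · simp only [hu, mt this.2 hu, if_false]
    exact hc' huv

theorem IsValid.update [DecidableEq V] {K : Type} {G G' : SimpleGraph V} {s : V → K} {x y : V}
    {z : K} (hs : IsValid G s) (hG : AddsEdge G G' x y)
    (hz : ∀ v, G'.Adj x v → s v ≠ z) : IsValid G' (Function.update s x z) := by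
  have key : ∀ v, G'.Adj x v → Function.update s x z x ≠ Function.update s x z v := fun v hv => by
    rw [Function.update_self, Function.update_of_ne hv.ne']
    exact (hz v hv).symm
  intro u v huv
  by_cases hu : u = x
  · subst hu
    exact key v huv
  · by_cases hv : v = x
    · subst hv
      exact (key u huv.symm).symm
    · rw [Function.update_of_ne hu, Function.update_of_ne hv]
      rcases (hG.adj_iff u v).1 huv with h | ⟨h, -⟩ | ⟨-, h⟩
      · exact hs h
      · exact absurd h hu
      · exact absurd h hv

end TwoColorings

/-! ### Distances between colorings -/

section Counting

variable {V : Type u} {α : Type} [DecidableEq α]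

/-- The number of elements of `X` on which `a` and `b` differ. -/
def dis (X : Finset V) (a b : V → α) : ℕ := (X.filter fun v => a v ≠ b v).card

theorem dis_le_card (X : Finset V) (a b : V → α) : dis X a b ≤ X.card :=
  Finset.card_filter_le _ _

theorem dis_congr {X : Finset V} {a b a' b' : V → α} (ha : ∀ v ∈ X, a v = a' v)
    (hb : ∀ v ∈ X, b v = b' v) : dis X a b = dis X a' b' := by
  unfold dis
  congr 1
  exact Finset.filter_congr fun v hv => by rw [ha v hv, hb v hv]

theorem dis_eq_zero {X : Finset V} {a b : V → α} (h : ∀ v ∈ X, a v = b v) : dis X a b = 0 := by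
  simpa [dis, Finset.filter_eq_empty_iff] using h

theorem dis_add_dis_compl [Fintype V] [DecidableEq V] (X : Finset V) (a b : V → α) :
    dis X a b + dis Xᶜ a b = dis Finset.univ a b := by
  unfold dis
  rw [← Finset.card_union_of_disjoint]
  · rw [← Finset.filter_union, Finset.union_compl]
  · exact Finset.disjoint_filter_filter disjoint_compl_right

theorem dis_sdiff_add [DecidableEq V] {X Y : Finset V} (h : Y ⊆ X) (a b : V → α) :
    dis (X \ Y) a b + dis Y a b = dis X a b := by
  unfold dis
  rw [← Finset.card_union_of_disjoint]
  · rw [← Finset.filter_union, Finset.sdiff_union_of_subset h]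
  · exact Finset.disjoint_filter_filter Finset.sdiff_disjoint

theorem dis_le_add [Fintype V] [DecidableEq V] (X : Finset V) {s s' a : V → α}
    (h : ∀ v ∉ X, s' v = s v) : dis Finset.univ s' a ≤ dis Finset.univ s a + X.card := by
  rw [← dis_add_dis_compl X s', ← dis_add_dis_compl X s,
    dis_congr (X := Xᶜ) (a := s') (a' := s) (b := a) (b' := a)
      (fun v hv => h v (by simpa using hv)) (fun _ _ => rfl)]
  have := dis_le_card X s' a
  omega

theorem dis_add_dis_of_ne {X : Finset V} {c h h' : V → Fin 2} (hne : ∀ v ∈ X, h v ≠ h' v) :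
    dis X c h + dis X c h' = X.card := by
  have : dis X c h' = (X.filter fun v => ¬ c v ≠ h v).card := by
    unfold dis
    congr 1
    refine Finset.filter_congr fun v hv => ?_
    have := hne v hv
    omega
  rw [this]
  exact Finset.card_filter_add_card_filter_not (s := X) (fun v => c v ≠ h v)

end Counting

/-! ### The invariant and its preservation at each arrival -/

section Invariant

variable {V : Type u} [Fintype V] {Δ : ℕ}

/-- The cost of the change from the coloring `s` to the coloring `s'`. -/
noncomputable def stepCost (w : Fin Δ → ℝ) (s s' : V → Palette Δ) : ℝ :=
  ∑ v : V, if s' v ≠ s v then price w (s' v) else 0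

theorem stepCost_le {w : Fin Δ → ℝ} {s s' : V → Palette Δ} {X : Finset V} {B : ℝ}
    (hX : ∀ v ∉ X, s' v = s v) (hB : ∀ v ∈ X, price w (s' v) ≤ B) :
    stepCost w s s' ≤ dis X s' s * B := by
  unfold stepCost dis
  rw [← Finset.sum_filter, ← nsmul_eq_mul]
  have : Finset.univ.filter (fun v => s' v ≠ s v) = X.filter (fun v => s' v ≠ s v) := by
    ext v
    simp only [Finset.mem_filter, Finset.mem_univ, true_and]
    exact ⟨fun h => ⟨by_contra fun hv => h (hX v hv), h⟩, And.right⟩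
  rw [this]
  exact Finset.sum_le_card_nsmul _ _ _ fun v hv => hB v (Finset.mem_filter.1 hv).1

/-- The bookkeeping of the analysis: a basic color for every vertex, the labels of the classes,
the number of times a vertex has been recolored on joining a larger component, the vertices that
the optimum can pay for, the vertices that ever had a special color, the edges that arrived
between vertices with equal basic colors and with equal special colors, and the number of
recolorings to the cheapest coloring of a component. -/
structure Ledger (V : Type u) where
  base : V → Fin 2
  label : V → V
  flips : V → ℕ
  paid : Finset V
  special : Finset V
  basicClash : Finset (Sym2 V)
  specialClash : Finset (Sym2 V)
  resets : ℕ

open Classical in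
/-- What the algorithm maintains on the graph `G` with the coloring `s` and the total cost `c`. -/
structure Inv (c₀ : V → Fin 2) (D : ℝ) (G : SimpleGraph V) (s : V → Palette Δ) (c : ℝ)
    (L : Ledger V) : Prop where
  valid : IsValid G s
  state : ∀ v, s v = Sum.inl (L.base v) ∨ (v ∈ L.special ∧ ∃ j, s v = Sum.inr j)
  labeling : Labeling D G L.label
  base_iff : ∀ h, IsValid G h → ∀ u v, L.label u = L.label v →
    (L.base u = h u ↔ L.base v = h v)
  paid_le : ∀ X : Finset V, (∀ u ∈ X, ∀ v, G.Adj u v → v ∈ X) → ∀ h, IsValid G h →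
    (L.paid ∩ X).card ≤ 4 * dis X c₀ h
  flips_comp : ∀ v, 2 ^ L.flips v ≤ (comp G v).card
  flips_le : ∀ v, (2 : ℝ) ^ L.flips v ≤ 2 * D
  flips_zero : ∀ v ∉ L.paid, L.flips v = 0
  basicClash : ∀ u v, s(u, v) ∈ L.basicClash → G.Adj u v ∧ L.label u ≠ L.label v ∧
    D ≤ (L.paid ∩ fiber L.label u).card
  specialClash : ∀ u v, s(u, v) ∈ L.specialClash → G.Adj u v ∧ u ∈ L.special
  special_le : L.special.card ≤ L.basicClash.card
  potential : ∀ h, IsValid G h → L.resets + dis Finset.univ s (fun v => Sum.inl (h v)) ≤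
    2 * dis Finset.univ c₀ h + ∑ v, L.flips v + L.basicClash.card + L.specialClash.card
  cost_le : c ≤ L.resets + ∑ v, (L.flips v : ℝ) +
    D * (L.basicClash.card + L.specialClash.card)

variable {c₀ : V → Fin 2} {D : ℝ} {w : Fin Δ → ℝ} {G G' : SimpleGraph V} {s : V → Palette Δ}
  {c : ℝ} {L : Ledger V} {x y : V}

theorem exists_inv_bot (hD : 1 ≤ D) :
    ∃ L, Inv c₀ D (⊥ : SimpleGraph V) (fun v => (Sum.inl (c₀ v) : Palette Δ)) 0 L := by
  classical
  refine ⟨⟨c₀, id, fun _ => 0, ∅, ∅, ∅, ∅, 0⟩, ?_⟩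
  refine ⟨fun _ _ h => h.elim, fun v => Or.inl rfl,
    ⟨connectedFibers_id _, fun v => Or.inl fun u hu => (SimpleGraph.reachable_bot.1 hu).symm⟩,
    ?_, by simp, fun v => Finset.card_pos.2 ⟨v, by simp⟩, fun v => ?_, fun _ _ => rfl,
    by simp, by simp, le_rfl, fun h _ => ?_, by simp⟩
  · rintro h - u v (rfl : u = v)
    rfl
  · rw [pow_zero]
    linarith
  · have : dis Finset.univ (fun v => (Sum.inl (c₀ v) : Palette Δ)) (fun v => Sum.inl (h v)) =
        dis Finset.univ c₀ h := by
      unfold dis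
      congr 1
      exact Finset.filter_congr fun v _ => by simp
    rw [this]
    simp
    omega

theorem Inv.label_step (hI : Inv c₀ D G s c L) (hG : AddsEdge G G' x y)
    (hcase : (G.Reachable x y ∨ (D ≤ ((comp G x).card : ℝ) ∧ D ≤ ((comp G y).card : ℝ))) ∨
      (¬ G.Reachable x y ∧ ((comp G x).card : ℝ) < D)) :
    ∃ f', Labeling D G' f' ∧ LabelStep G G' x L.label f' := by
  rcases hcase with h | h
  · exact ⟨_, hI.labeling.keep hG h, LabelStep.refl _ _ _ _⟩
  · exact ⟨_, hI.labeling.merge hG h.1 h.2⟩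

open Classical in
-- Old clashes keep their charge: their two classes are never merged with each other and never
-- split, and the paid set only grows.
theorem Inv.basicClash_step (hI : Inv c₀ D G s c L) (hG : G ≤ G') {f' : V → V}
    (hf : LabelStep G G' x L.label f') {P : Finset V} (hP : L.paid ⊆ P) (u v : V)
    (huv : s(u, v) ∈ L.basicClash) :
    G'.Adj u v ∧ f' u ≠ f' v ∧ D ≤ (P ∩ fiber f' u).card := by
  obtain ⟨hadj, hne, hD⟩ := hI.basicClash u v huv
  refine ⟨hG hadj, hf.ne u v hadj hne, hD.trans ?_⟩
  exact_mod_cast Finset.card_le_card (Finset.inter_subset_inter hP fun w hw => by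
    rw [mem_fiber] at *
    exact hf.mono u v hadj hne w hw)

theorem Inv.flips_comp_step (hI : Inv c₀ D G s c L) (hG : G ≤ G') (v : V) :
    2 ^ L.flips v ≤ (comp G' v).card :=
  (hI.flips_comp v).trans (Finset.card_le_card (comp_mono hG v))

open Classical in
-- The bound is stated for every union `X` of components so that it can be localized: the old bound
-- is applied to `X` without the new component, and that component, if it lies in `X`, pays for
-- itself by `hK`. No vertex is charged twice.
theorem Inv.paid_le_step (hI : Inv c₀ D G s c L) (hG : G ≤ G')
    (hK : ∀ h, IsValid G' h → (comp G' x).card ≤ 4 * dis (comp G' x) c₀ h)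
    (X : Finset V) (hX : ∀ u ∈ X, ∀ v, G'.Adj u v → v ∈ X) (h : V → Fin 2) (hh : IsValid G' h) :
    ((L.paid ∪ comp G' x) ∩ X).card ≤ 4 * dis X c₀ h := by
  have hreach : ∀ u v, G'.Reachable u v → u ∈ X → v ∈ X := by
    rintro u v ⟨p⟩
    induction p with
    | nil => exact id
    | cons hab p ih => exact fun hu => ih (hX _ hu _ hab)
  by_cases hxX : x ∈ X
  · have hsub : comp G' x ⊆ X := fun v hv => hreach x v (mem_comp.1 hv) hxX
    have h1 := hI.paid_le (X \ comp G' x) (fun u hu v huv => by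
      rw [Finset.mem_sdiff, mem_comp] at *
      refine ⟨hX u hu.1 v (hG huv), fun h' => hu.2 (h'.trans (hG huv).symm.reachable)⟩) h
      (hh.mono hG)
    have h2 := hK h hh
    have h3 := dis_sdiff_add hsub c₀ h
    have h4 : (L.paid ∪ comp G' x) ∩ X ⊆ (L.paid ∩ (X \ comp G' x)) ∪ comp G' x := by
      intro v
      simp only [Finset.mem_inter, Finset.mem_union, Finset.mem_sdiff]
      tauto
    have h5 := (Finset.card_le_card h4).trans (Finset.card_union_le _ _)
    omega
  · have h1 : (L.paid ∪ comp G' x) ∩ X = L.paid ∩ X := by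
      ext v
      simp only [Finset.mem_inter, Finset.mem_union, mem_comp]
      have : v ∈ X → ¬ G'.Reachable x v := fun hv hr => hxX (hreach v x hr.symm hv)
      tauto
    rw [h1]
    exact hI.paid_le X (fun u hu v huv => hX u hu v (hG huv)) h (hh.mono hG)

theorem Inv.adj_of_mem_clash (hI : Inv c₀ D G s c L) {u v : V}
    (h : s(u, v) ∈ L.basicClash ∨ s(u, v) ∈ L.specialClash) : G.Adj u v :=
  h.elim (fun h => (hI.basicClash u v h).1) (fun h => (hI.specialClash u v h).1)

open Classical in
/-- The component of the new edge is recolored with a coloring that differs from the initial one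
in less than a quarter of its vertices. -/
theorem Inv.reset (hI : Inv c₀ D G s c L) (hG : AddsEdge G G' x y)
    {f' : V → V} (hf : Labeling D G' f') (hff : LabelStep G G' x L.label f')
    {h₀ : V → Fin 2} (hh₀ : IsValid G' h₀)
    (hK : 4 * dis (comp G' x) c₀ h₀ < (comp G' x).card) :
    ∃ s' L', Inv c₀ D G' s' (c + stepCost w s s') L' := by
  set K := comp G' x with hKdef
  let s' : V → Palette Δ := fun v => if v ∈ K then Sum.inl (h₀ v) else s v
  have hin : ∀ v ∈ K, s' v = Sum.inl (h₀ v) := fun v hv => by simp [s', hv]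
  have hout : ∀ v ∉ K, s' v = s v := fun v hv => by simp [s', hv]
  have hclosed : ∀ u v, G'.Adj u v → (u ∈ K ↔ v ∈ K) := fun u v huv => by
    simp only [hKdef, mem_comp]
    exact ⟨(·.trans huv.reachable), (·.trans huv.symm.reachable)⟩
  have hxK : x ∈ K := by simp [hKdef]
  have hyK : y ∈ K := (hclosed x y hG.adj).1 hxK
  refine ⟨s', ⟨fun v => if v ∈ K then h₀ v else L.base v, f', L.flips, L.paid, L.special,
    L.basicClash, L.specialClash, L.resets + dis K s (fun v => Sum.inl (h₀ v))⟩, ?_⟩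
  refine ⟨?_, ?_, hf, ?_, ?_, hI.flips_comp_step hG.le, hI.flips_le, hI.flips_zero,
    hI.basicClash_step hG.le hff subset_rfl, ?_, hI.special_le, ?_, ?_⟩
  · intro u v huv
    by_cases hu : u ∈ K
    · rw [hin u hu, hin v ((hclosed u v huv).1 hu)]
      exact fun h => hh₀ huv (Sum.inl_injective h)
    · rw [hout u hu, hout v (mt (hclosed u v huv).2 hu)]
      rcases (hG.adj_iff u v).1 huv with h | ⟨rfl, -⟩ | ⟨rfl, -⟩
      · exact hI.valid h
      · exact absurd hxK hu
      · exact absurd hyK hu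
  · intro v
    by_cases hv : v ∈ K
    · left
      simp [hin v hv, hv]
    · rw [hout v hv]
      simpa [hv] using hI.state v
  · intro h hh u v huv
    have hr := hf.conn.reachable huv
    by_cases hu : u ∈ K
    · have hv : v ∈ K := by
        rw [hKdef, mem_comp] at *
        exact hu.trans hr
      simp only [hu, hv, if_true]
      exact hh₀.eq_iff_of_reachable hh hr
    · have hv : v ∉ K := fun hv => hu (by
        rw [hKdef, mem_comp] at *
        exact hv.trans hr.symm)
      simp only [hu, hv, if_false]
      rcases hff.eq_or u v huv with h' | h'
      · exact hI.base_iff h (hh.mono hG.le) u v h'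
      · exact absurd (mem_comp.2 h'.1) hu
  · intro X hX h hh
    exact hI.paid_le X (fun u hu v huv => hX u hu v (hG.le huv)) h (hh.mono hG.le)
  · exact fun u v huv => ⟨hG.le (hI.specialClash u v huv).1, (hI.specialClash u v huv).2⟩
  · intro h hh
    -- The old potential is taken at the coloring that is `h₀` on `K` and `h` elsewhere: its
    -- distance on `K` is exactly what the reset adds to `resets`.
    let h₁ : V → Fin 2 := fun v => if v ∈ K then h₀ v else h v
    have hp := hI.potential h₁ ((hh₀.piecewise hh).mono hG.le)
    have h1in : ∀ v ∈ K, h₁ v = h₀ v := fun v hv => by simp [h₁, hv]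
    have h1out : ∀ v ∈ Kᶜ, h₁ v = h v := fun v hv => by
      rw [Finset.mem_compl] at hv
      simp [h₁, hv]
    have e1 := dis_add_dis_compl K s (fun v => (Sum.inl (h₁ v) : Palette Δ))
    have e2 := dis_add_dis_compl K s' (fun v => (Sum.inl (h v) : Palette Δ))
    have e3 := dis_add_dis_compl K c₀ h₁
    have e4 := dis_add_dis_compl K c₀ h
    rw [dis_congr (X := K) (a := s) (fun _ _ => rfl) (fun v hv => by rw [h1in v hv]),
      dis_congr (X := Kᶜ) (a := s) (fun _ _ => rfl) (fun v hv => by rw [h1out v hv])] at e1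
    rw [dis_congr (X := Kᶜ) (a := s') (a' := s)
      (fun v hv => hout v (Finset.mem_compl.1 hv)) (fun _ _ => rfl)] at e2
    rw [dis_congr (X := K) (a := c₀) (fun _ _ => rfl) h1in,
      dis_congr (X := Kᶜ) (a := c₀) (fun _ _ => rfl) h1out] at e3
    by_cases heq : h x = h₀ x
    · have hall : ∀ v ∈ K, h v = h₀ v := fun v hv =>
        (hh.eq_iff_of_reachable hh₀ (mem_comp.1 hv)).1 heq
      have e5 : dis K s' (fun v => (Sum.inl (h v) : Palette Δ)) = 0 :=
        dis_eq_zero fun v hv => by rw [hin v hv, hall v hv]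
      have e6 : dis K c₀ h = dis K c₀ h₀ := dis_congr (fun _ _ => rfl) hall
      simp only
      omega
    -- Here `h` is opposite to `h₀` on `K`, so it differs from `c₀` on |K| − d vertices of `K`,
    -- where d < |K|/4 is the number for `h₀`. Then 2(|K| − d) − 2d > |K| covers the new distance,
    -- at most |K|; this is why the factor 2 goes with the threshold of a quarter.
    · have hall : ∀ v ∈ K, h v ≠ h₀ v := fun v hv h' =>
        heq ((hh.eq_iff_of_reachable hh₀ (mem_comp.1 hv)).2 h')
      have e5 := dis_le_card K s' (fun v => (Sum.inl (h v) : Palette Δ))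
      have e6 := dis_add_dis_of_ne (c := c₀) hall
      simp only
      omega
  · have hc := hI.cost_le
    have hs : stepCost w s s' ≤ dis K s' s * 1 :=
      stepCost_le hout (fun v hv => by simp [hin v hv, price])
    have e : dis K s' s = dis K s (fun v => Sum.inl (h₀ v)) := by
      unfold dis
      congr 1
      exact Finset.filter_congr fun v hv => by rw [hin v hv]; exact ne_comm
    rw [e] at hs
    push_cast
    linarith

open Classical in
/-- The smaller of two components is recolored to fit the larger one. -/
theorem Inv.flip (hI : Inv c₀ D G s c L) (hG : AddsEdge G G' x y) (hxy : ¬ G.Reachable x y)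
    (hle : (comp G x).card ≤ (comp G y).card) (hx : ((comp G x).card : ℝ) < D)
    {g : V → Fin 2} (hg : IsValid G' g)
    (hK : ∀ h, IsValid G' h → (comp G' x).card ≤ 4 * dis (comp G' x) c₀ h) :
    ∃ s' L', Inv c₀ D G' s' (c + stepCost w s s') L' := by
  set K := comp G x with hKdef
  obtain ⟨hf, hff⟩ := hI.labeling.merge hG hxy hx
  set f' := mergeLabel G x y L.label with hf'
  have hxK : x ∈ K := by simp [hKdef]
  have hyK : y ∉ K := by simpa [hKdef] using hxy
  have hclosed : ∀ u v, G.Adj u v → (u ∈ K ↔ v ∈ K) := fun u v huv => by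
    simp only [hKdef, mem_comp]
    exact ⟨(·.trans huv.reachable), (·.trans huv.symm.reachable)⟩
  have hlab : ∀ v ∈ K, L.label v = L.label x := fun v hv =>
    hI.labeling.eq_of_small hx (mem_comp.1 hv)
  -- `K` is one class, so swapping its two basic colors keeps them consistent; the swap is made only
  -- if the new edge would clash.
  let b' : V → Fin 2 := fun v =>
    if v ∈ K then (if L.base x = L.base y then L.base v + 1 else L.base v) else L.base v
  have bout : ∀ v ∉ K, b' v = L.base v := fun v hv => by simp [b', hv]
  have bxy : b' x ≠ b' y := by
    rw [bout y hyK]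
    simp only [b', hxK, if_true]
    split_ifs with h
    · rw [h]; omega
    · exact h
  have binK : ∀ h, IsValid G h → ∀ v ∈ K, (b' v = h v ↔ b' x = h x) := by
    intro h hh v hv
    have := hI.base_iff h hh v x (hlab v hv)
    simp only [b', hxK, hv, if_true]
    split_ifs
    · omega
    · exact this
  have bfix : ∀ h, IsValid G' h → ∀ v, f' v = L.label y → (b' v = h v ↔ b' y = h y) := by
    intro h hh v hv
    by_cases hvK : v ∈ K
    · rw [binK h (hh.mono hG.le) v hvK]
      have := hh hG.adj
      omega
    · rw [bout v hvK, bout y hyK]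
      refine hI.base_iff h (hh.mono hG.le) v y ?_
      rw [hKdef, mem_comp] at hvK
      simpa [hf', mergeLabel, hvK] using hv
  let s' : V → Palette Δ := fun v => if v ∈ K then Sum.inl (b' v) else s v
  have hin : ∀ v ∈ K, s' v = Sum.inl (b' v) := fun v hv => by simp [s', hv]
  have hout : ∀ v ∉ K, s' v = s v := fun v hv => by simp [s', hv]
  have s'xy : s' x ≠ s' y := by
    rw [hin x hxK, hout y hyK]
    rcases hI.state y with h | ⟨-, j, h⟩
    · rw [h, ← bout y hyK]
      exact fun h => bxy (Sum.inl_injective h)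
    · rw [h]
      exact Sum.inl_ne_inr
  have hsum : ∑ v, (if v ∈ K then L.flips v + 1 else L.flips v) = ∑ v, L.flips v + K.card := by
    have : ∀ v, (if v ∈ K then L.flips v + 1 else L.flips v) =
        L.flips v + if v ∈ K then 1 else 0 := fun v => by split_ifs <;> rfl
    simp only [this, Finset.sum_add_distrib]
    simp
  have hcompK : ∀ v ∈ K, comp G v = K := by
    intro v hv
    rw [hKdef, mem_comp] at hv
    ext u
    rw [hKdef, mem_comp, mem_comp]
    exact ⟨hv.trans, hv.symm.trans⟩
  have hKsub : K ⊆ comp G' x := comp_mono hG.le x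
  refine ⟨s', ⟨b', f', fun v => if v ∈ K then L.flips v + 1 else L.flips v,
    L.paid ∪ comp G' x, L.special, L.basicClash, L.specialClash, L.resets⟩, ?_⟩
  refine ⟨?_, ?_, hf, ?_, hI.paid_le_step hG.le hK, ?_, ?_, ?_,
    hI.basicClash_step hG.le hff Finset.subset_union_left, ?_, hI.special_le, ?_, ?_⟩
  · intro u v huv
    rcases (hG.adj_iff u v).1 huv with h | ⟨rfl, rfl⟩ | ⟨rfl, rfl⟩
    · by_cases hu : u ∈ K
      · have hv := (hclosed u v h).1 hu
        rw [hin u hu, hin v hv]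
        have e1 := binK g (hg.mono hG.le) u hu
        have e2 := binK g (hg.mono hG.le) v hv
        have e3 := hg huv
        exact fun h => by
          have := Sum.inl_injective h
          omega
      · rw [hout u hu, hout v (mt (hclosed u v h).2 hu)]
        exact hI.valid h
    · exact s'xy
    · exact s'xy.symm
  · intro v
    by_cases hv : v ∈ K
    · exact Or.inl (hin v hv)
    · rw [hout v hv]
      simp only [bout v hv]
      exact hI.state v
  · intro h hh u v huv
    simp only at huv ⊢
    by_cases hu : f' u = L.label y
    · rw [bfix h hh u hu, bfix h hh v (huv.symm.trans hu)]
    · have hoff : ∀ z, f' z ≠ L.label y → z ∉ K ∧ f' z = L.label z := by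
        intro z hz
        have : ¬ G.Reachable x z := fun h => hz (by simp [hf', mergeLabel, h])
        exact ⟨by simpa [hKdef] using this, by simp [hf', mergeLabel, this]⟩
      have hu' := hoff u hu
      have hv' := hoff v (huv ▸ hu)
      rw [bout u hu'.1, bout v hv'.1]
      exact hI.base_iff h (hh.mono hG.le) u v (by rw [← hu'.2, ← hv'.2, huv])
  · intro v
    simp only
    split_ifs with hv
    · have h1 := hI.flips_comp v
      rw [hcompK v hv] at h1
      -- The new component contains both disjoint old ones, and that of `y` is no smaller than `K`:
      -- the size at least doubles.
      have h2 : K.card + (comp G y).card ≤ (comp G' v).card := by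
        rw [← Finset.card_union_of_disjoint]
        · refine Finset.card_le_card fun u hu => ?_
          have hxv : G'.Reachable v x := (mem_comp.1 (hKsub hv)).symm
          rw [mem_comp]
          rcases Finset.mem_union.1 hu with hu | hu
          · exact hxv.trans (mem_comp.1 (hKsub hu))
          · exact (hxv.trans hG.adj.reachable).trans ((mem_comp.1 hu).mono hG.le)
        · rw [Finset.disjoint_left]
          intro u hu hu'
          rw [hKdef, mem_comp] at *
          exact hxy (hu.trans hu'.symm)
      rw [pow_succ]
      omega
    · exact hI.flips_comp_step hG.le v
  · intro v
    simp only
    split_ifs with hv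
    · have h1 := hI.flips_comp v
      rw [hcompK v hv] at h1
      have h2 : (2 : ℝ) ^ L.flips v ≤ K.card := by exact_mod_cast h1
      rw [pow_succ]
      linarith
    · exact hI.flips_le v
  · intro v hv
    simp only [Finset.mem_union, not_or] at hv
    have : v ∉ K := fun h => hv.2 (hKsub h)
    simp only [this, if_false]
    exact hI.flips_zero v hv.1
  · exact fun u v huv => ⟨hG.le (hI.specialClash u v huv).1, (hI.specialClash u v huv).2⟩
  · intro h hh
    -- The distance grows by at most |K|, exactly the growth of the sum of `flips`.
    have e1 := hI.potential h (hh.mono hG.le)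
    have e2 := dis_le_add K (a := fun v => (Sum.inl (h v) : Palette Δ)) hout
    simp only [hsum]
    omega
  · have hc := hI.cost_le
    have hs : stepCost w s s' ≤ dis K s' s * 1 :=
      stepCost_le hout (fun v hv => by simp [hin v hv, price])
    have e : (dis K s' s : ℝ) ≤ K.card := by exact_mod_cast dis_le_card K s' s
    have hsum' : ∑ v, (((if v ∈ K then L.flips v + 1 else L.flips v : ℕ)) : ℝ) =
        ∑ v, (L.flips v : ℝ) + K.card := by exact_mod_cast hsum
    simp only [hsum']
    linarith

/-- A vertex of degree at most `Δ` has a free special color or may take any basic one: if all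
special colors occur at its neighbors, then no basic color does. -/
theorem exists_free_color [DecidableRel G'.Adj] (hdeg : G'.degree x ≤ Δ) (b : Fin 2) :
    ∃ z : Palette Δ, (z = Sum.inl b ∨ ∃ j, z = Sum.inr j) ∧ ∀ v, G'.Adj x v → s v ≠ z := by
  classical
  by_contra! hcon
  obtain ⟨v₀, hv₀, hb⟩ := hcon (Sum.inl b) (Or.inl rfl)
  choose v hv hsv using fun j => hcon (Sum.inr j) (Or.inr ⟨j, rfl⟩)
  have hinj : Function.Injective v := fun i j hij =>
    Sum.inr_injective ((hsv i).symm.trans ((congrArg s hij).trans (hsv j)))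
  -- One neighbor per special color and one of color `b` would be Δ + 1 distinct neighbors.
  have hsub : insert v₀ (Finset.univ.image v) ⊆ G'.neighborFinset x := by
    intro u hu
    rw [SimpleGraph.mem_neighborFinset]
    rcases Finset.mem_insert.1 hu with rfl | hu
    · exact hv₀
    · obtain ⟨j, -, rfl⟩ := Finset.mem_image.1 hu
      exact hv j
  have hnot : v₀ ∉ Finset.univ.image v := by
    intro h
    obtain ⟨j, -, h⟩ := Finset.mem_image.1 h
    have := hsv j
    rw [h, hb] at this
    exact Sum.inl_ne_inr this
  have := Finset.card_le_card hsub
  rw [Finset.card_insert_of_notMem hnot, Finset.card_image_of_injective _ hinj,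
    Finset.card_univ, Fintype.card_fin, SimpleGraph.card_neighborFinset_eq_degree] at this
  omega

open Classical in
/-- One endpoint of the new edge is recolored if necessary. -/
theorem Inv.patch (hI : Inv c₀ D G s c L) (hG : AddsEdge G G' x y) (hD : 1 ≤ D)
    (hw : ∀ j, 0 ≤ w j ∧ w j ≤ D) (hdeg : G'.degree x ≤ Δ)
    (hxy : G.Reachable x y ∨ (D ≤ ((comp G x).card : ℝ) ∧ D ≤ ((comp G y).card : ℝ)))
    {g : V → Fin 2} (hg : IsValid G' g)
    (hK : ∀ h, IsValid G' h → (comp G' x).card ≤ 4 * dis (comp G' x) c₀ h) :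
    ∃ s' L', Inv c₀ D G' s' (c + stepCost w s s') L' := by
  have hf := hI.labeling.keep hG hxy
  have hff := LabelStep.refl G G' x L.label
  have hbase : ∀ h, IsValid G' h → ∀ u v, L.label u = L.label v →
    (L.base u = h u ↔ L.base v = h v) := fun h hh => hI.base_iff h (hh.mono hG.le)
  have hzero : ∀ v ∉ L.paid ∪ comp G' x, L.flips v = 0 := fun v hv =>
    hI.flips_zero v fun h => hv (Finset.mem_union_left _ h)
  have hsc : ∀ u v, s(u, v) ∈ L.specialClash → G'.Adj u v ∧ u ∈ L.special :=
    fun u v huv => ⟨hG.le (hI.specialClash u v huv).1, (hI.specialClash u v huv).2⟩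
  by_cases hs : s x = s y
  · have hnadj : ¬ G.Adj x y := fun h => hI.valid h hs
    have hnb : s(x, y) ∉ L.basicClash := fun h => hnadj (hI.adj_of_mem_clash (Or.inl h))
    have hns : s(x, y) ∉ L.specialClash := fun h => hnadj (hI.adj_of_mem_clash (Or.inr h))
    obtain ⟨z, hz, hfree⟩ := exists_free_color (s := s) hdeg (L.base x)
    set s' := Function.update s x z with hs'
    have hvalid : IsValid G' s' := hI.valid.update hG hfree
    have hout : ∀ v ∉ ({x} : Finset V), s' v = s v := fun v hv =>
      Function.update_of_ne (by simpa using hv) _ _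
    have hstate : ∀ S, L.special ⊆ S → x ∈ S →
        ∀ v, s' v = Sum.inl (L.base v) ∨ (v ∈ S ∧ ∃ j, s' v = Sum.inr j) := by
      intro S hS hxS v
      by_cases hv : v = x
      · subst hv
        rw [hs', Function.update_self]
        exact hz.imp id fun h => ⟨hxS, h⟩
      · rw [hs', Function.update_of_ne hv]
        exact (hI.state v).imp id fun h => ⟨hS h.1, h.2⟩
    have hcost : stepCost w s s' ≤ D := by
      have h1 : stepCost w s s' ≤ dis {x} s' s * D := by
        refine stepCost_le hout fun v hv => ?_
        rw [Finset.mem_singleton] at hv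
        subst hv
        rw [hs', Function.update_self]
        rcases hz with rfl | ⟨j, rfl⟩
        · exact hD
        · exact (hw j).2
      have h2 : (dis {x} s' s : ℝ) ≤ 1 := by exact_mod_cast dis_le_card {x} s' s
      nlinarith
    have hpot : ∀ h : V → Fin 2, dis Finset.univ s' (fun v => (Sum.inl (h v) : Palette Δ)) ≤
        dis Finset.univ s (fun v => (Sum.inl (h v) : Palette Δ)) + 1 := fun h =>
      dis_le_add {x} hout
    have hc := hI.cost_le
    rcases hI.state x with hx | ⟨hxS, j, hx⟩
    · have hy : s y = Sum.inl (L.base y) := by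
        rcases hI.state y with h | ⟨-, j, h⟩
        · exact h
        · rw [← hs, hx] at h
          exact absurd h Sum.inl_ne_inr
      have hb : L.base x = L.base y := Sum.inl_injective (hx.symm.trans (hs.trans hy))
      -- Inside a class the basic colors are consistent with `g`, which separates `x` from `y`;
      -- equal basic colors therefore force different classes.
      have hlab : L.label x ≠ L.label y := by
        intro h
        have h1 := hbase g hg x y h
        have h2 := hg hG.adj
        omega
      have hfib : ∀ u, u = x ∨ u = y → D ≤ ((L.paid ∪ comp G' x) ∩ fiber L.label u).card := by
        intro u hu
        -- If `x` and `y` were already connected, neither class is a whole component, so both are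
        -- large; otherwise both components have size at least `D`.
        have h1 : D ≤ (fiber L.label u).card := by
          rcases hxy with hxy | ⟨hx', hy'⟩
          · rcases hI.labeling.large u with h | h
            · exfalso
              rcases hu with rfl | rfl
              · exact hlab (h y hxy).symm
              · exact hlab (h x hxy.symm)
            · exact h
          · rcases hu with rfl | rfl
            · exact hI.labeling.le_card_fiber hx'
            · exact hI.labeling.le_card_fiber hy'
        refine h1.trans ?_
        exact_mod_cast Finset.card_le_card fun v hv => by
          rw [mem_fiber] at hv
          rw [Finset.mem_inter, mem_fiber, Finset.mem_union, mem_comp]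
          refine ⟨Or.inr ?_, hv⟩
          have hr := hf.conn.reachable hv.symm
          rcases hu with rfl | rfl
          · exact hr
          · exact hG.adj.reachable.trans hr
      have hcard := Finset.card_insert_of_notMem hnb
      refine ⟨s', ⟨L.base, L.label, L.flips, L.paid ∪ comp G' x, insert x L.special,
        insert s(x, y) L.basicClash, L.specialClash, L.resets⟩, ?_⟩
      refine ⟨hvalid, hstate _ (Finset.subset_insert _ _) (Finset.mem_insert_self _ _), hf, hbase,
        hI.paid_le_step hG.le hK, hI.flips_comp_step hG.le, hI.flips_le, hzero,
        ?_, fun u v huv => ⟨(hsc u v huv).1, Finset.mem_insert_of_mem (hsc u v huv).2⟩, ?_, ?_, ?_⟩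
      · intro u v huv
        rcases Finset.mem_insert.1 huv with h | h
        · rcases Sym2.eq_iff.1 h with ⟨rfl, rfl⟩ | ⟨rfl, rfl⟩
          · exact ⟨hG.adj, hlab, hfib _ (Or.inl rfl)⟩
          · exact ⟨hG.adj.symm, hlab.symm, hfib _ (Or.inr rfl)⟩
        · exact hI.basicClash_step hG.le hff Finset.subset_union_left u v h
      · simp only [hcard]
        have := Finset.card_insert_le x L.special
        have := hI.special_le
        omega
      · intro h hh
        have := hI.potential h (hh.mono hG.le)
        have := hpot h
        simp only [hcard]
        omega
      · simp only [hcard]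
        push_cast
        linarith
    · have hyS : y ∈ L.special := by
        rcases hI.state y with h | h
        · rw [← hs, hx] at h
          exact absurd h.symm Sum.inl_ne_inr
        · exact h.1
      have hcard := Finset.card_insert_of_notMem hns
      refine ⟨s', ⟨L.base, L.label, L.flips, L.paid ∪ comp G' x, L.special,
        L.basicClash, insert s(x, y) L.specialClash, L.resets⟩, ?_⟩
      refine ⟨hvalid, hstate _ subset_rfl hxS, hf, hbase,
        hI.paid_le_step hG.le hK, hI.flips_comp_step hG.le, hI.flips_le, hzero,
        hI.basicClash_step hG.le hff Finset.subset_union_left, ?_, hI.special_le, ?_, ?_⟩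
      · intro u v huv
        rcases Finset.mem_insert.1 huv with h | h
        · rcases Sym2.eq_iff.1 h with ⟨rfl, rfl⟩ | ⟨rfl, rfl⟩
          · exact ⟨hG.adj, hxS⟩
          · exact ⟨hG.adj.symm, hyS⟩
        · exact hsc u v h
      · intro h hh
        have := hI.potential h (hh.mono hG.le)
        have := hpot h
        simp only [hcard]
        omega
      · simp only [hcard]
        push_cast
        linarith
  · refine ⟨s, ⟨L.base, L.label, L.flips, L.paid ∪ comp G' x, L.special,
        L.basicClash, L.specialClash, L.resets⟩, ?_⟩
    refine ⟨?_, hI.state, hf, hbase, hI.paid_le_step hG.le hK, hI.flips_comp_step hG.le,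
      hI.flips_le, hzero, hI.basicClash_step hG.le hff Finset.subset_union_left, hsc,
      hI.special_le, fun h hh => hI.potential h (hh.mono hG.le), ?_⟩
    · intro u v huv
      rcases (hG.adj_iff u v).1 huv with h | ⟨rfl, rfl⟩ | ⟨rfl, rfl⟩
      · exact hI.valid h
      · exact hs
      · exact Ne.symm hs
    · have : stepCost w s s = 0 := by simp [stepCost]
      rw [this, add_zero]
      exact hI.cost_le

open Classical in
/-- Every arrival of a legal edge can be served with the invariant kept. -/
theorem Inv.step (hI : Inv c₀ D G s c L) (hG : AddsEdge G G' x y) (hD : 1 ≤ D)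
    (hw : ∀ j, 0 ≤ w j ∧ w j ≤ D) (hdeg : ∀ v, G'.degree v ≤ Δ)
    {g : V → Fin 2} (hg : IsValid G' g) :
    ∃ s' L', Inv c₀ D G' s' (c + stepCost w s s') L' := by
  have main : ∀ x y, AddsEdge G G' x y →
      ((G.Reachable x y ∨ (D ≤ ((comp G x).card : ℝ) ∧ D ≤ ((comp G y).card : ℝ))) ∨
      (¬ G.Reachable x y ∧ (comp G x).card ≤ (comp G y).card ∧ ((comp G x).card : ℝ) < D)) →
      ∃ s' L', Inv c₀ D G' s' (c + stepCost w s s') L' := by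
    intro x y hG hcase
    obtain ⟨f', hf, hff⟩ := hI.label_step hG (hcase.imp id fun h => ⟨h.1, h.2.2⟩)
    by_cases hK : ∀ h, IsValid G' h → (comp G' x).card ≤ 4 * dis (comp G' x) c₀ h
    · rcases hcase with h | ⟨h1, h2, h3⟩
      · exact hI.patch hG hD hw (hdeg x) h hg hK
      · exact hI.flip hG h1 h2 h3 hg hK
    · push Not at hK
      obtain ⟨h₀, hh₀, hlt⟩ := hK
      exact hI.reset hG hf hff hh₀ hlt
  -- The roles of `x` and `y` are chosen so that `x` lies in the smaller component; unless both
  -- components reach `D`, that one is below `D`.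
  by_cases hr : G.Reachable x y
  · exact main x y hG (Or.inl (Or.inl hr))
  · by_cases hDD : D ≤ ((comp G x).card : ℝ) ∧ D ≤ ((comp G y).card : ℝ)
    · exact main x y hG (Or.inl (Or.inr hDD))
    · rcases le_total (comp G x).card (comp G y).card with hle | hle
      · refine main x y hG (Or.inr ⟨hr, hle, lt_of_not_ge fun h => hDD ⟨h, h.trans ?_⟩⟩)
        exact_mod_cast hle
      · refine main y x hG.symm (Or.inr ⟨fun h => hr h.symm, hle,
          lt_of_not_ge fun h => hDD ⟨h.trans ?_, h⟩⟩)
        exact_mod_cast hle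

end Invariant

/-! ### From the invariant to the competitive ratio -/

section Bounds

variable {V : Type u} [Fintype V] {Δ : ℕ} {c₀ : V → Fin 2} {D : ℝ} {w : Fin Δ → ℝ}
  {G : SimpleGraph V} {s : V → Palette Δ} {c : ℝ} {L : Ledger V}

/-- Basic clashes touch only classes with at least `D` paid vertices. The classes are disjoint, so
there are at most #paid / `D` of them, each accounting for at most β clashes. -/
theorem Inv.basicClash_le (hI : Inv c₀ D G s c L) :
    D * L.basicClash.card ≤ largestBond G * L.paid.card := by
  classical
  set T : Finset V := Finset.univ.filter
    (fun i => D ≤ (L.paid.filter fun v => L.label v = i).card) with hT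
  have h1 : L.basicClash.card ≤ largestBond G * T.card := by
    refine card_le_largestBond_mul T L.label L.basicClash hI.labeling.conn fun u v huv => ?_
    obtain ⟨hadj, hne, hD⟩ := hI.basicClash u v huv
    refine ⟨hadj, hne, ?_⟩
    rw [hT, Finset.mem_filter]
    refine ⟨Finset.mem_univ _, hD.trans ?_⟩
    exact_mod_cast Finset.card_le_card fun z hz => by
      rw [Finset.mem_inter, mem_fiber] at hz
      exact Finset.mem_filter.2 hz
  have h2 : T.card * D ≤ (L.paid.card : ℝ) := by
    have h3 : ∑ i ∈ T, (L.paid.filter fun v => L.label v = i).card ≤ L.paid.card := by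
      rw [Finset.card_eq_sum_card_fiberwise (s := L.paid) (t := Finset.univ) (f := L.label)
        (fun _ _ => Finset.mem_coe.2 (Finset.mem_univ _))]
      exact Finset.sum_le_sum_of_subset (Finset.subset_univ _)
    have h4 : ∑ _i ∈ T, D ≤ ∑ i ∈ T, ((L.paid.filter fun v => L.label v = i).card : ℝ) :=
      Finset.sum_le_sum fun i hi => (Finset.mem_filter.1 hi).2
    rw [Finset.sum_const, nsmul_eq_mul] at h4
    refine h4.trans ?_
    exact_mod_cast h3
  rcases le_or_gt 0 D with hD | hD
  · calc D * L.basicClash.card ≤ D * ((largestBond G * T.card : ℕ) : ℝ) :=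
        mul_le_mul_of_nonneg_left (by exact_mod_cast h1) hD
      _ = largestBond G * (T.card * D) := by push_cast; ring
      _ ≤ largestBond G * L.paid.card := mul_le_mul_of_nonneg_left h2 (Nat.cast_nonneg _)
  · exact (mul_nonpos_of_nonpos_of_nonneg hD.le (Nat.cast_nonneg _)).trans (by positivity)

/-- The contraction count with singleton classes, where the touched classes are the vertices of
`special`. -/
theorem Inv.specialClash_le (hI : Inv c₀ D G s c L) :
    L.specialClash.card ≤ largestBond G * L.basicClash.card := by
  refine le_trans ?_ (Nat.mul_le_mul_left _ hI.special_le)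
  refine card_le_largestBond_mul L.special id L.specialClash (connectedFibers_id G)
    fun u v huv => ?_
  obtain ⟨hadj, hu⟩ := hI.specialClash u v huv
  exact ⟨hadj, hadj.ne, hu⟩

theorem Inv.sum_flips_le (hI : Inv c₀ D G s c L) (hD : 1 ≤ D) :
    ∑ v, (L.flips v : ℝ) ≤ L.paid.card * (1 + 2 * Real.log D) := by
  classical
  have hlog := Real.log_nonneg hD
  have h1 : ∀ v, (L.flips v : ℝ) ≤ 1 + 2 * Real.log D := by
    intro v
    have h := Real.log_le_log (by positivity) (hI.flips_le v)
    rw [Real.log_pow, Real.log_mul (by norm_num) (by linarith)] at h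
    -- Only log 2 > 1/2 matters: 2^k ≤ 2D gives k ≤ 1 + log D / log 2 ≤ 1 + 2 log D.
    have h2 := Real.log_two_gt_d9
    by_contra! hcon
    nlinarith
  have h0 : ∑ v, (L.flips v : ℝ) = ∑ v ∈ L.paid, (L.flips v : ℝ) := by
    refine (Finset.sum_subset (Finset.subset_univ _) fun v _ hv => ?_).symm
    rw [hI.flips_zero v hv, Nat.cast_zero]
  rw [h0, ← nsmul_eq_mul]
  exact Finset.sum_le_card_nsmul _ _ _ fun v _ => h1 v

theorem Inv.cost_le_mul_dis (hI : Inv c₀ D G s c L) (hD : 1 ≤ D) (hβ : 1 ≤ largestBond G)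
    {h : V → Fin 2} (hh : IsValid G h) :
    c ≤ 26 * (Real.log D + (largestBond G : ℝ) ^ 2) * dis Finset.univ c₀ h := by
  classical
  have hlog := Real.log_nonneg hD
  have hc := hI.cost_le
  have hp : (L.resets : ℝ) ≤ 2 * dis Finset.univ c₀ h + ∑ v, (L.flips v : ℝ) +
      L.basicClash.card + L.specialClash.card := by
    have := hI.potential h hh
    have h' : L.resets ≤ 2 * dis Finset.univ c₀ h + ∑ v, L.flips v + L.basicClash.card +
      L.specialClash.card := by omega
    exact_mod_cast h'
  have hpaid : (L.paid.card : ℝ) ≤ 4 * dis Finset.univ c₀ h := by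
    have := hI.paid_le Finset.univ (fun _ _ _ _ => Finset.mem_univ _) h hh
    rw [Finset.inter_univ] at this
    exact_mod_cast this
  have hf := hI.sum_flips_le hD
  have hb := hI.basicClash_le
  have hs : (L.specialClash.card : ℝ) ≤ largestBond G * L.basicClash.card := by
    exact_mod_cast hI.specialClash_le
  have hβ' : (1 : ℝ) ≤ largestBond G := by exact_mod_cast hβ
  set β : ℝ := ((largestBond G : ℕ) : ℝ)
  set H : ℝ := ((dis Finset.univ c₀ h : ℕ) : ℝ)
  set A : ℝ := ((L.basicClash.card : ℕ) : ℝ)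
  set S : ℝ := ((L.specialClash.card : ℕ) : ℝ)
  set P : ℝ := ((L.paid.card : ℕ) : ℝ)
  set Φ : ℝ := ∑ v, (L.flips v : ℝ)
  have hH : 0 ≤ H := Nat.cast_nonneg _
  have hA : 0 ≤ A := Nat.cast_nonneg _
  have hS : 0 ≤ S := Nat.cast_nonneg _
  have hf' : Φ ≤ 4 * H * (1 + 2 * Real.log D) :=
    hf.trans (mul_le_mul_of_nonneg_right hpaid (by linarith))
  have hb' : D * A ≤ β * (4 * H) := hb.trans (mul_le_mul_of_nonneg_left hpaid (by linarith))
  have hs' : D * S ≤ β * (β * (4 * H)) := by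
    calc D * S ≤ D * (β * A) := mul_le_mul_of_nonneg_left hs (by linarith)
      _ = β * (D * A) := by ring
      _ ≤ β * (β * (4 * H)) := mul_le_mul_of_nonneg_left hb' (by linarith)
  have hAD : A ≤ D * A := le_mul_of_one_le_left hA hD
  have hSD : S ≤ D * S := le_mul_of_one_le_left hS hD
  have hβH : β * H ≤ β ^ 2 * H := mul_le_mul_of_nonneg_right (by nlinarith) hH
  have hHH : H ≤ β * H := le_mul_of_one_le_left hH hβ'
  have hlH : 0 ≤ Real.log D * H := mul_nonneg hlog hH
  -- The cost is at most 2H + 2Φ + 2D(A + S), with 2Φ ≤ 8H + 16 H log D and 2D(A + S) ≤ 8βH + 8β²H ≤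
  -- 16β²H. Since H ≤ β²H, the coefficient 10 + 16 = 26 suffices.
  nlinarith

end Bounds

/-! ### The online algorithm and the offline optimum -/

section Algorithm

variable {V : Type u}

theorem inputGraph_adj {σ : List (Sym2 V)} {u v : V} :
    (inputGraph σ).Adj u v ↔ s(u, v) ∈ σ ∧ u ≠ v := by
  simp [inputGraph]

theorem inputGraph_nil : inputGraph ([] : List (Sym2 V)) = ⊥ := by
  ext u v
  simp [inputGraph_adj]

theorem addsEdge_inputGraph {σ : List (Sym2 V)} {x y : V} (hxy : x ≠ y) :
    AddsEdge (inputGraph σ) (inputGraph (σ ++ [s(x, y)])) x y := by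
  refine ⟨fun u v => ?_⟩
  simp only [inputGraph_adj, List.mem_append, List.mem_singleton, Sym2.eq_iff]
  constructor
  · tauto
  · rintro (h | ⟨rfl, rfl⟩ | ⟨rfl, rfl⟩)
    · tauto
    · exact ⟨by simp, hxy⟩
    · exact ⟨by simp, hxy.symm⟩

theorem inputGraph_mono {σ τ : List (Sym2 V)} (h : ∀ e ∈ σ, e ∈ τ) :
    inputGraph σ ≤ inputGraph τ := fun u v huv => by
  rw [inputGraph_adj] at *
  exact ⟨h _ huv.1, huv.2⟩

variable [Fintype V] {Δ : ℕ}

theorem IsBipartiteInput.of_append {σ τ : List (Sym2 V)} (h : IsBipartiteInput Δ (σ ++ τ)) :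
    IsBipartiteInput Δ σ := by
  classical
  have hle : inputGraph σ ≤ inputGraph (σ ++ τ) :=
    inputGraph_mono fun e he => List.mem_append_left _ he
  refine ⟨fun e he => h.1 e (List.mem_append_left _ he), h.2.1.mono_left hle, ?_⟩
  exact (SimpleGraph.maxDegree_mono hle).trans h.2.2

theorem IsBipartiteInput.exists_isValid {σ : List (Sym2 V)} (h : IsBipartiteInput Δ σ) :
    ∃ g : V → Fin 2, IsValid (inputGraph σ) g := by
  obtain ⟨g⟩ := h.2.1
  exact ⟨g, fun _ _ hxy => g.valid hxy⟩

variable (c₀ : V → Fin 2) (D : ℝ) (w : Fin Δ → ℝ)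

open Classical in
/-- The next coloring: any one that keeps the invariant of the analysis. -/
noncomputable def nextColoring (σ : List (Sym2 V)) (p : (V → Palette Δ) × ℝ) : V → Palette Δ :=
  -- The ledger need not be remembered, only its existence, and β does not enter. The default is
  -- never reached on legal inputs.
  if h : ∃ s', ∃ L, Inv c₀ D (inputGraph σ) s' (p.2 + stepCost w p.1 s') L then h.choose else p.1

/-- The prefix that has arrived, the coloring, and the total cost, after the arrival of `e`. -/
noncomputable def advance (p : List (Sym2 V) × (V → Palette Δ) × ℝ) (e : Sym2 V) :
    List (Sym2 V) × (V → Palette Δ) × ℝ :=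
  let s' := nextColoring c₀ D w (p.1 ++ [e]) p.2
  (p.1 ++ [e], s', p.2.2 + stepCost w p.2.1 s')

/-- The state of the algorithm after the arrival of the edges of `σ`. -/
noncomputable def runState (σ : List (Sym2 V)) : List (Sym2 V) × (V → Palette Δ) × ℝ :=
  σ.foldl (advance c₀ D w) ([], fun v => Sum.inl (c₀ v), 0)

theorem runState_append (σ : List (Sym2 V)) (e : Sym2 V) :
    runState c₀ D w (σ ++ [e]) = advance c₀ D w (runState c₀ D w σ) e := by
  simp [runState]

theorem runState_fst (σ : List (Sym2 V)) : (runState c₀ D w σ).1 = σ := by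
  induction σ using List.reverseRecOn with
  | nil => rfl
  | append_singleton σ e ih => rw [runState_append, advance, ih]

/-- The online algorithm of the main theorem. -/
noncomputable def algorithm :
    OnlineAlgorithm V (Palette Δ) (fun v => Sum.inl (c₀ v)) where
  coloring σ := (runState c₀ D w σ).2.1
  init := rfl

variable {c₀ D w}

theorem exists_inv_runState (hD : 1 ≤ D) (hw : ∀ j, 0 ≤ w j ∧ w j ≤ D) (σ : List (Sym2 V))
    (hσ : IsBipartiteInput Δ σ) :
    ∃ L, Inv c₀ D (inputGraph σ) (runState c₀ D w σ).2.1 (runState c₀ D w σ).2.2 L := by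
  classical
  induction σ using List.reverseRecOn with
  | nil =>
    rw [inputGraph_nil]
    exact exists_inv_bot hD
  | append_singleton σ e ih =>
    obtain ⟨L, hI⟩ := ih hσ.of_append
    obtain ⟨g, hg⟩ := hσ.exists_isValid
    have hex : ∃ s', ∃ L, Inv c₀ D (inputGraph (σ ++ [e])) s'
        ((runState c₀ D w σ).2.2 + stepCost w (runState c₀ D w σ).2.1 s') L := by
      induction e using Sym2.ind with
      | h x y =>
      have hxy : x ≠ y := fun h => hσ.1 s(x, y) (by simp) (Sym2.mk_isDiag_iff.2 h)
      refine hI.step (addsEdge_inputGraph hxy) hD hw (fun v => ?_) hg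
      refine (SimpleGraph.degree_le_maxDegree _ v).trans (le_trans (le_of_eq ?_) hσ.2.2)
      congr!
    rw [runState_append, advance, runState_fst]
    have hnext : nextColoring c₀ D w (σ ++ [e]) (runState c₀ D w σ).2 = hex.choose :=
      dif_pos hex
    rw [hnext]
    exact hex.choose_spec

theorem runState_cost (σ : List (Sym2 V)) :
    (runState c₀ D w σ).2.2 = totalCost (price w) σ.length ((algorithm c₀ D w).run σ) := by
  induction σ using List.reverseRecOn with
  | nil => simp [runState, totalCost]
  | append_singleton σ e ih =>
    have hpre : ∀ i ≤ σ.length,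
        (algorithm c₀ D w).run (σ ++ [e]) i = (algorithm c₀ D w).run σ i := fun i hi => by
      simp only [OnlineAlgorithm.run, List.take_append_of_le_length hi]
    have hlast : (algorithm c₀ D w).run (σ ++ [e]) (σ.length + 1) =
        (runState c₀ D w (σ ++ [e])).2.1 := by
      simp only [OnlineAlgorithm.run, algorithm]
      rw [List.take_of_length_le (by simp)]
    have hprev : (algorithm c₀ D w).run (σ ++ [e]) σ.length = (runState c₀ D w σ).2.1 := by
      rw [hpre _ le_rfl]
      simp only [OnlineAlgorithm.run, algorithm, List.take_length]
    rw [List.length_append, List.length_singleton, totalCost, Finset.sum_range_succ, hlast, hprev,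
      Finset.sum_congr rfl (g := fun i => ∑ v, if (algorithm c₀ D w).run σ (i + 1) v ≠
        (algorithm c₀ D w).run σ i v then price w ((algorithm c₀ D w).run σ (i + 1) v) else 0)
        (fun i hi => by
          rw [Finset.mem_range] at hi
          rw [hpre (i + 1) hi, hpre i hi.le])]
    rw [totalCost] at ih
    rw [← ih, runState_append]
    rfl

theorem dis_le_totalCost {s : ℕ → V → Fin 2} (m : ℕ) :
    (dis Finset.univ (s 0) (s m) : ℝ) ≤ totalCost (fun _ => 1) m s := by
  rw [totalCost, Finset.sum_comm, dis, Finset.card_filter]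
  push_cast
  refine Finset.sum_le_sum fun v _ => ?_
  have hnn : ∀ i ∈ Finset.range m, (0 : ℝ) ≤ if s (i + 1) v ≠ s i v then 1 else 0 :=
    fun i _ => by split_ifs <;> norm_num
  split_ifs with h
  · obtain ⟨i, hi, hne⟩ : ∃ i ∈ Finset.range m, s (i + 1) v ≠ s i v := by
      by_contra! hcon
      have : ∀ i ≤ m, s i v = s 0 v := by
        intro i
        induction i with
        | zero => exact fun _ => rfl
        | succ i ih => exact fun hi => (hcon i (Finset.mem_range.2 hi)).trans (ih (by omega))
      exact h (this m le_rfl).symm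
    refine le_trans (le_of_eq ?_) (Finset.single_le_sum hnn hi)
    rw [if_pos hne]
  · exact Finset.sum_nonneg hnn

/-- The optimum is at least the least number of vertices that a valid final coloring changes. -/
theorem le_optTwo {σ : List (Sym2 V)} {B : ℝ} (hσ : IsBipartiteInput Δ σ)
    (hB : ∀ h, IsValid (inputGraph σ) h → B ≤ dis Finset.univ c₀ h) : B ≤ optTwo c₀ σ := by
  refine le_csInf ?_ ?_
  · obtain ⟨g, hg⟩ := hσ.exists_isValid
    -- Some offline solution exists: switch to a valid final coloring at the first step and keep it.
    refine ⟨_, fun i => if i = 0 then c₀ else g, ⟨by simp, fun i hi => ?_⟩, rfl⟩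
    by_cases h : i = 0
    · subst h
      rw [List.take_zero, inputGraph_nil]
      exact fun _ _ h => h.elim
    · simp only [h, if_false]
      exact hg.mono (inputGraph_mono fun e he => List.mem_of_mem_take he)
  · rintro x ⟨s, ⟨h0, hs⟩, rfl⟩
    have hv := hs σ.length le_rfl
    rw [List.take_length] at hv
    refine (hB _ hv).trans ?_
    rw [← h0]
    exact dis_le_totalCost σ.length

end Algorithm

end Recoloring

open Recoloring in
theorem mainTheorem7 :
    ∃ C : ℝ, 0 < C ∧
      ∀ (V : Type u) [Fintype V] (c₀ : V → Fin 2) (Δ : ℕ) (D : ℝ) (w : Fin Δ → ℝ),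
        1 ≤ D → (∀ j, 0 ≤ w j ∧ w j ≤ D) →
        ∃ alg : OnlineAlgorithm V (Palette Δ) (fun v => Sum.inl (c₀ v)),
          ∀ σ : List (Sym2 V), IsBipartiteInput Δ σ →
            Serves (fun v => Sum.inl (c₀ v)) σ (alg.run σ) ∧
            totalCost (price w) σ.length (alg.run σ) ≤
              C * (Real.log D + (largestBond (inputGraph σ) : ℝ) ^ 2) * optTwo c₀ σ := by
  refine ⟨26, by norm_num, fun V _ c₀ Δ D w hD hw => ⟨algorithm c₀ D w, fun σ hσ => ⟨⟨?_, ?_⟩, ?_⟩⟩⟩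
  · exact (algorithm c₀ D w).init
  · intro i _
    have hpre : IsBipartiteInput Δ (σ.take i) := by
      rw [← List.take_append_drop i σ] at hσ
      exact hσ.of_append
    obtain ⟨L, hI⟩ := exists_inv_runState (c₀ := c₀) hD hw _ hpre
    exact hI.valid
  · have hlog := Real.log_nonneg hD
    have hopt : 0 ≤ optTwo c₀ σ := le_optTwo hσ fun _ _ => Nat.cast_nonneg _
    -- Without edges the ratio may vanish, as for `D` = 1, so the empty input is treated apart;
    -- there the cost is 0.
    cases σ with
    | nil =>
      simp only [List.length_nil, totalCost, Finset.range_zero, Finset.sum_empty]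
      positivity
    | cons e τ =>
      set σ := e :: τ
      obtain ⟨L, hI⟩ := exists_inv_runState (c₀ := c₀) hD hw _ hσ
      have hβ : 1 ≤ largestBond (inputGraph σ) := by
        induction e using Sym2.ind with
        | h x y =>
        refine one_le_largestBond (x := x) (y := y) (inputGraph_adj.2 ⟨by simp [σ], fun h => ?_⟩)
        exact hσ.1 s(x, y) (by simp [σ]) (Sym2.mk_isDiag_iff.2 h)
      have hpos : 0 < 26 * (Real.log D + (largestBond (inputGraph σ) : ℝ) ^ 2) := by
        have : (1 : ℝ) ≤ largestBond (inputGraph σ) := by exact_mod_cast hβ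
        positivity
      -- Dividing by the ratio leaves a lower bound on the optimum, which may be checked on each
      -- valid final coloring.
      rw [← runState_cost, mul_comm, ← div_le_iff₀ hpos]
      refine le_optTwo hσ fun h hh => ?_
      rw [div_le_iff₀ hpos, mul_comm]
      exact hI.cost_le_mul_dis hD hβ hh
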